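/- Let $\delta>0$ and $\varepsilon$ be real numbers with $C=\delta^2-16\ln(2)\,\varepsilon>0$. For positive integers $r_1,\dots,r_d$ let $G=K_{r_1}\square\cdots\square K_{r_d}$ be the Cartesian product of complete graphs, with graph distance $\mathrm{dist}$. For nonempty sets $S,T$ of vertices of $G$ put $d_*(S,T)=\min\{\mathrm{dist}(s,t): s\in S,\ t\in T\}$, and for real $\rho$ let $$\widehat m_\rho(a,b)=\{u:\ \mathrm{dist}(a,u)\in\{\lfloor\rho\,\mathrm{dist}(a,b)\rfloor,\ \lceil(1-\rho)\,\mathrm{dist}(a,b)\rceil\},\ \mathrm{dist}(a,u)+\mathrm{dist}(u,b)=\mathrm{dist}(a,b)\},\qquad \widehat m_\rho(S,T)=\bigcup_{a\in S,\,b\in T}\widehat m_\rho(a,b).$$ Then there are a function $o:\mathbb N\to\mathbb R$ with $o(d)\to0$ as $d\to\infty$ and an integer $D$, both depending only on $\delta$ and $\varepsilon$, such that for all $d\ge D$, all $\rho$ with $|1/2-\rho|<\varepsilon$, all $r_1,\dots,r_d$, and all nonempty $S,T\subseteq V(G)$ with $d_*(S,T)\ge\delta d$, $$|\widehat m_\rho(S,T)|>\sqrt{|S||T|}\;e^{C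 d\,(1/2+o(d))}.$$ -/

import Mathlib

open Filter Topology

/-- The Cartesian product of a family of graphs: two vertices are adjacent when they are adjacent
in one coordinate and agree in all the others. -/
def cartesianProduct {ι : Type*} {V : ι → Type*} (G : ∀ i, SimpleGraph (V i)) :
    SimpleGraph (∀ i, V i) where
  Adj u v := ∃ i, (G i).Adj (u i) (v i) ∧ ∀ j, j ≠ i → u j = v j
  symm := ⟨fun _ _ ⟨i, h, hj⟩ => ⟨i, h.symm, fun j hne => (hj j hne).symm⟩⟩
  loopless := ⟨fun _ ⟨_, h, _⟩ => h.ne rfl⟩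

/-- The Cartesian product of the complete graphs on `r i` vertices, `i < d`. -/
def completeProduct {d : ℕ} (r : Fin d → ℕ) : SimpleGraph (∀ i, Fin (r i)) :=
  cartesianProduct fun i => SimpleGraph.completeGraph (Fin (r i))

/-- The distance between two sets of vertices, the least graph distance between a vertex of `S`
and a vertex of `T` (meaningful when both sets are nonempty). -/
noncomputable def setDist {V : Type*} (G : SimpleGraph V) (S T : Set V) : ℕ :=
  sInf {n | ∃ s ∈ S, ∃ t ∈ T, G.dist s t = n}

/-- The symmetric discrete `ρ`-midpoints of two vertices. -/
def symMidpoints {V : Type*} (G : SimpleGraph V) (ρ : ℝ) (a b : V) : Set V :=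
  {u | (G.dist a u : ℤ) = ⌊ρ * (G.dist a b : ℝ)⌋ ∧ G.dist a u + G.dist u b = G.dist a b} ∪
  {u | (G.dist a u : ℤ) = ⌈(1 - ρ) * (G.dist a b : ℝ)⌉ ∧ G.dist a u + G.dist u b = G.dist a b}

/-- The symmetric discrete `ρ`-midpoints of two sets of vertices. -/
def symMidpointSet {V : Type*} (G : SimpleGraph V) (ρ : ℝ) (S T : Set V) : Set V :=
  ⋃ a ∈ S, ⋃ b ∈ T, symMidpoints G ρ a b

/-! The proof is a discrete Prékopa–Leindler induction on the coordinates. Distance is Hamming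
distance, so a point between `a` and `b` copies `a` or `b` in each coordinate. The state `(j, l)`
counts the differing coordinates already sliced off in which the point copied `b`, respectively `a`.

The bound carried along is `|S||T| exp (2 * gain - c ^ 2 * d) ≤ |B(S,T)||B(T,S)|`, where `B` is
`betweenSet`. When `a` and `b` differ in the sliced coordinate, either one may be copied, and the
two successor gains average to the current gain minus `c`. `sum_mul_sum_exp_le` turns this drop into
a factor `exp (-c ^ 2)` per coordinate.

The induction stops once `j + l = M` or `|j - l| = H`. There the gain is nonpositive, and the
injection of `card_mul_card_le_betweenSet` suffices. At `(0, 0)`, with `c = M / d`, `M ≈ (δ - 4ε)d`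
and `H ≈ εd`, the exponent is `(δ - 4ε)² d - O(1)`, which exceeds `C d` for large `d`; thus `o = 0`
works. -/

/-! ### One-dimensional inequalities -/

theorem cosh_weighted_le {c σ τ h : ℝ} (hc : 0 ≤ c) (hσ : 0 ≤ σ) (hστ : σ ≤ τ) (h2 : τ ≤ h)
    (h3 : Real.exp (2 * c) * (σ * τ) ≤ h ^ 2) :
    Real.exp (c - c ^ 2 / 2) * ((σ + τ) / 2) ≤ h := by
  have hτ : 0 ≤ τ := hσ.trans hστ
  have hh : 0 ≤ h := hτ.trans h2
  -- If the ratio `τ / σ` is at least `exp (2c)`, then `τ ≤ h` suffices. Otherwise the arithmetic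
  -- mean is the geometric mean times `cosh` of an argument at most `c`, and `h3` bounds the
  -- geometric mean. Both cases use `cosh x ≤ exp (x² / 2)`.
  rcases le_total (Real.exp (2 * c) * σ) τ with hle | hle
  · have h1 : σ ≤ Real.exp (-(2 * c)) * τ := by
      rw [Real.exp_neg, ← div_eq_inv_mul, le_div_iff₀ (Real.exp_pos _)]
      linarith
    have h4 : Real.exp (c - c ^ 2 / 2) * ((1 + Real.exp (-(2 * c))) / 2) ≤ 1 := by
      have e1 : Real.exp (c - c ^ 2 / 2) * ((1 + Real.exp (-(2 * c))) / 2)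
          = Real.exp (-(c ^ 2 / 2)) * Real.cosh c := by
        rw [Real.cosh_eq, show c - c ^ 2 / 2 = -(c ^ 2 / 2) + c by ring, Real.exp_add,
          show Real.exp (-c) = Real.exp c * Real.exp (-(2 * c)) by
            rw [← Real.exp_add]; ring_nf]
        ring
      rw [e1, Real.exp_neg, ← div_eq_inv_mul, div_le_one (Real.exp_pos _)]
      exact Real.cosh_le_exp_half_sq c
    calc Real.exp (c - c ^ 2 / 2) * ((σ + τ) / 2)
        ≤ Real.exp (c - c ^ 2 / 2) * ((Real.exp (-(2 * c)) * τ + τ) / 2) := by gcongr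
      _ = (Real.exp (c - c ^ 2 / 2) * ((1 + Real.exp (-(2 * c))) / 2)) * τ := by ring
      _ ≤ 1 * τ := by gcongr
      _ ≤ h := by linarith
  · rcases hσ.eq_or_lt with h0 | hpos
    · subst h0
      have : τ = 0 := le_antisymm (by simpa using hle) hτ
      subst this
      simpa using hh
    have hτ0 : 0 < τ := hpos.trans_le hστ
    set a := Real.log σ with ha
    set b := Real.log τ with hb
    have hσe : σ = Real.exp a := (Real.exp_log hpos).symm
    have hτe : τ = Real.exp b := (Real.exp_log hτ0).symm
    have hab : a ≤ b := Real.log_le_log hpos hστ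
    have hbc : b - a ≤ 2 * c := by
      rw [hσe, hτe, ← Real.exp_add, Real.exp_le_exp] at hle
      linarith
    have hcosh : (σ + τ) / 2 = Real.exp ((a + b) / 2) * Real.cosh ((b - a) / 2) := by
      rw [Real.cosh_eq, mul_div_assoc', mul_add, ← Real.exp_add, ← Real.exp_add, hσe, hτe]
      ring_nf
    have hsq : Real.exp (c + (a + b) / 2) ≤ h := by
      refine le_of_sq_le_sq ?_ hh
      rw [← Real.exp_nat_mul]
      refine le_trans (le_of_eq ?_) h3
      rw [hσe, hτe, ← Real.exp_add, ← Real.exp_add]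
      push_cast
      ring_nf
    refine le_trans ?_ hsq
    rw [hcosh]
    calc Real.exp (c - c ^ 2 / 2) * (Real.exp ((a + b) / 2) * Real.cosh ((b - a) / 2))
        ≤ Real.exp (c - c ^ 2 / 2) * (Real.exp ((a + b) / 2) *
            Real.exp (((b - a) / 2) ^ 2 / 2)) := by
          gcongr; exact Real.cosh_le_exp_half_sq _
      _ = Real.exp (c - c ^ 2 / 2 + ((a + b) / 2 + ((b - a) / 2) ^ 2 / 2)) := by
          rw [Real.exp_add, Real.exp_add]
      _ ≤ Real.exp (c + (a + b) / 2) := by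
          rw [Real.exp_le_exp]; nlinarith

theorem exp_mul_mean_le {c σ τ h : ℝ} (hc : 0 ≤ c) (hσ : 0 ≤ σ) (hτ : 0 ≤ τ) (h1 : σ ≤ h)
    (h2 : τ ≤ h) (h3 : Real.exp (2 * c) * (σ * τ) ≤ h ^ 2) :
    Real.exp (c - c ^ 2 / 2) * ((σ + τ) / 2) ≤ h := by
  rcases le_total σ τ with h | h
  · exact cosh_weighted_le hc hσ h h2 h3
  · rw [add_comm]
    exact cosh_weighted_le hc hτ h h1 (by rwa [mul_comm τ σ])

/-- A Prékopa–Leindler type inequality on the one-dimensional space `ι`, with a curvature gain. -/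
theorem sum_mul_sum_exp_le_sq {ι : Type*} [Fintype ι] {s t h : ι → ℝ} {c K : ℝ} (hc : 0 ≤ c)
    (hK : 0 < K) (hs : ∀ x, 0 ≤ s x) (ht : ∀ x, 0 ≤ t x) (hh : ∀ x, 0 ≤ h x)
    (hdiag : ∀ x, Real.exp (2 * c) * K ^ 2 * (s x * t x) ≤ h x ^ 2)
    (hoff : ∀ x y, x ≠ y → K ^ 2 * (s x * t y) ≤ h x * h y) :
    K ^ 2 * Real.exp (2 * c - c ^ 2) * ((∑ x, s x) * ∑ x, t x) ≤ (∑ x, h x) ^ 2 := by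
  have hall : ∀ x y, K ^ 2 * (s x * t y) ≤ h x * h y := by
    intro x y
    by_cases hxy : x = y
    · subst hxy
      have h1 := hdiag x
      have h2 : 1 ≤ Real.exp (2 * c) := Real.one_le_exp (by linarith)
      have h3 : 0 ≤ K ^ 2 * (s x * t x) := by have := hs x; have := ht x; positivity
      nlinarith
    · exact hoff x y hxy
  by_cases hs0 : ∀ x, s x = 0
  · simp only [hs0, Finset.sum_const_zero, zero_mul, mul_zero]
    positivity
  by_cases ht0 : ∀ x, t x = 0
  · simp only [ht0, Finset.sum_const_zero, mul_zero]
    positivity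
  push Not at hs0 ht0
  obtain ⟨x₁, hx₁⟩ := hs0
  obtain ⟨y₁, hy₁⟩ := ht0
  have hne : (Finset.univ.filter fun x => s x ≠ 0).Nonempty := ⟨x₁, by simp [hx₁]⟩
  -- Minimality makes `e` the largest scaling with `e * s ≤ h / K` everywhere; the product bound at
  -- `x₀` then gives `t / e ≤ h / K`.
  obtain ⟨x₀, hx₀, hmin⟩ := Finset.exists_min_image _ (fun x => h x / s x) hne
  have hsx₀ : 0 < s x₀ := lt_of_le_of_ne (hs _) (Ne.symm (by simpa using hx₀))
  have hhx₀ : 0 < h x₀ := by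
    have h1 := hall x₀ y₁
    have h2 : 0 < t y₁ := lt_of_le_of_ne (ht _) (Ne.symm hy₁)
    have h3 : 0 < K ^ 2 * (s x₀ * t y₁) := by positivity
    exact pos_of_mul_pos_left (h3.trans_le h1) (hh _)
  set e := h x₀ / (s x₀ * K) with he
  have hepos : 0 < e := by positivity
  have heK : e * K * s x₀ = h x₀ := by rw [he]; field_simp
  have hS : ∀ x, e * s x ≤ h x / K := by
    intro x
    rw [le_div_iff₀ hK]
    rcases (hs x).eq_or_lt with h0 | h0
    · rw [← h0]; simpa using hh x
    · have := hmin x (by simp [h0.ne'])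
      rw [le_div_iff₀ h0] at this
      refine le_trans (le_of_eq ?_) this
      rw [he]; field_simp
  have hT : ∀ x, t x / e ≤ h x / K := by
    intro x
    rw [div_le_div_iff₀ hepos hK]
    have h1 := hall x₀ x
    rw [← heK] at h1
    have h2 : (K * s x₀) * (t x * K) ≤ (K * s x₀) * (h x * e) := by linarith
    exact le_of_mul_le_mul_left h2 (by positivity)
  have hpt : ∀ x, Real.exp (c - c ^ 2 / 2) * ((e * s x + t x / e) / 2) ≤ h x / K := by
    intro x
    refine exp_mul_mean_le hc (mul_nonneg hepos.le (hs x)) (div_nonneg (ht x) hepos.le)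
      (hS x) (hT x) ?_
    rw [div_pow, le_div_iff₀ (by positivity)]
    refine le_trans (le_of_eq ?_) (hdiag x)
    field_simp
  have hsum := Finset.sum_le_sum fun x (_ : x ∈ Finset.univ) => hpt x
  rw [← Finset.mul_sum, ← Finset.sum_div, ← Finset.sum_div, Finset.sum_add_distrib,
    ← Finset.mul_sum, ← Finset.sum_div, le_div_iff₀ hK] at hsum
  set A := ∑ x, s x
  set B := ∑ x, t x
  have hA : 0 ≤ A := Finset.sum_nonneg fun x _ => hs x
  have hB : 0 ≤ B := Finset.sum_nonneg fun x _ => ht x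
  have hAB : A * B ≤ ((e * A + B / e) / 2) ^ 2 := by
    have h1 : A * B = (e * A) * (B / e) := by field_simp
    rw [h1]
    nlinarith [sq_nonneg (e * A - B / e)]
  calc K ^ 2 * Real.exp (2 * c - c ^ 2) * (A * B)
      ≤ K ^ 2 * Real.exp (2 * c - c ^ 2) * ((e * A + B / e) / 2) ^ 2 := by gcongr
    _ = (Real.exp (c - c ^ 2 / 2) * ((e * A + B / e) / 2) * K) ^ 2 := by
        rw [mul_pow, mul_pow, ← Real.exp_nat_mul,
          show ((2 : ℕ) : ℝ) * (c - c ^ 2 / 2) = 2 * c - c ^ 2 by push_cast; ring]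
        ring
    _ ≤ (∑ x, h x) ^ 2 := by gcongr

/-- The previous inequality is applied to `h = √(αβ)`: multiplying the two off-diagonal bounds gives
its hypothesis, and Cauchy–Schwarz separates `α` from `β` in the conclusion. -/
theorem sum_mul_sum_exp_le {ι : Type*} [Fintype ι] {s t α β : ι → ℝ} {c E E₁ E₂ : ℝ}
    (hc : 0 ≤ c) (hs : ∀ x, 0 ≤ s x) (ht : ∀ x, 0 ≤ t x) (hα : ∀ x, 0 ≤ α x)
    (hβ : ∀ x, 0 ≤ β x) (hE : E₁ + E₂ = 2 * (E - 2 * c))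
    (hdiag : ∀ x, s x * t x * Real.exp E ≤ α x * β x)
    (hoff₁ : ∀ x y, x ≠ y → s x * t y * Real.exp E₁ ≤ α x * β y)
    (hoff₂ : ∀ x y, x ≠ y → s x * t y * Real.exp E₂ ≤ α y * β x) :
    (∑ x, s x) * (∑ x, t x) * Real.exp (E - c ^ 2) ≤ (∑ x, α x) * ∑ x, β x := by
  have key := sum_mul_sum_exp_le_sq (s := s) (t := t) (h := fun x => √(α x) * √(β x))
    (K := Real.exp ((E - 2 * c) / 2)) hc (Real.exp_pos _) hs ht (fun x => by positivity)
    (fun x => ?_) (fun x y hxy => ?_)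
  · rw [← Real.exp_nat_mul, ← Real.exp_add] at key
    calc _ = Real.exp (((2 : ℕ) : ℝ) * ((E - 2 * c) / 2) + (2 * c - c ^ 2)) *
          ((∑ x, s x) * ∑ x, t x) := by
          rw [mul_comm]; congr 2; push_cast; ring
      _ ≤ _ := key
      _ ≤ (√(∑ x, α x) * √(∑ x, β x)) ^ 2 := by
          gcongr
          exact Real.sum_sqrt_mul_sqrt_le _ hα hβ
      _ = _ := by
          rw [mul_pow, Real.sq_sqrt (Finset.sum_nonneg fun x _ => hα x),
            Real.sq_sqrt (Finset.sum_nonneg fun x _ => hβ x)]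
  · rw [mul_pow, Real.sq_sqrt (hα x), Real.sq_sqrt (hβ x), ← Real.exp_nat_mul, ← Real.exp_add]
    refine le_trans (le_of_eq ?_) (hdiag x)
    rw [mul_comm]; congr 2; push_cast; ring
  · refine le_of_sq_le_sq ?_ (by positivity)
    have h1 : (√(α x) * √(β x) * (√(α y) * √(β y))) ^ 2 = (α x * β y) * (α y * β x) := by
      simp only [mul_pow, Real.sq_sqrt (hα _), Real.sq_sqrt (hβ _)]; ring
    rw [h1]
    have hst : 0 ≤ s x * t y := mul_nonneg (hs x) (ht y)
    refine le_trans (le_of_eq ?_) (mul_le_mul (hoff₁ x y hxy) (hoff₂ x y hxy) (by positivity)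
      (mul_nonneg (hα x) (hβ y)))
    rw [show s x * t y * Real.exp E₁ * (s x * t y * Real.exp E₂) =
      (s x * t y) ^ 2 * (Real.exp E₁ * Real.exp E₂) by ring, mul_pow, ← pow_mul,
      ← Real.exp_nat_mul, ← Real.exp_add, hE, mul_comm]
    congr 2; push_cast; ring

/-! ### Graph distance as Hamming distance -/

theorem hammingDist_le_one_of_adj {d : ℕ} {r : Fin d → ℕ} {u v : ∀ i, Fin (r i)}
    (h : (completeProduct r).Adj u v) : hammingDist u v ≤ 1 := by
  obtain ⟨i, -, hi⟩ := h
  refine (Finset.card_le_card (t := {i}) fun j hj => ?_).trans (by simp)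
  by_contra hne
  exact (Finset.mem_filter.1 hj).2 (hi j (by simpa using hne))

theorem hammingDist_le_length {d : ℕ} {r : Fin d → ℕ} {u v : ∀ i, Fin (r i)}
    (p : (completeProduct r).Walk u v) : hammingDist u v ≤ p.length := by
  induction p with
  | nil => simp
  | cons h p ih =>
    rw [SimpleGraph.Walk.length_cons]
    have := hammingDist_le_one_of_adj h
    exact (hammingDist_triangle _ _ _).trans ((Nat.add_le_add this ih).trans (by omega))

theorem exists_walk_length_eq_hammingDist {d : ℕ} {r : Fin d → ℕ} (n : ℕ) :
    ∀ u v : (∀ i, Fin (r i)), hammingDist u v = n →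
      ∃ p : (completeProduct r).Walk u v, p.length = n := by
  induction n with
  | zero =>
    intro u v h
    obtain rfl := hammingDist_eq_zero.1 h
    exact ⟨.nil, rfl⟩
  | succ n ih =>
    intro u v h
    have hne : u ≠ v := by
      rintro rfl
      simp at h
    obtain ⟨i, hi⟩ := Function.ne_iff.1 hne
    have hadj : (completeProduct r).Adj u (Function.update u i (v i)) := by
      refine ⟨i, by simpa using hi, fun j hj => by simp [hj]⟩
    have hcard : hammingDist (Function.update u i (v i)) v = n := by
      have : (Finset.univ.filter fun j => Function.update u i (v i) j ≠ v j)
          = (Finset.univ.filter fun j => u j ≠ v j).erase i := by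
        ext j
        by_cases hj : j = i
        · subst hj; simp
        · simp [hj]
      unfold hammingDist at h ⊢
      rw [this, Finset.card_erase_of_mem (by simpa using hi), h]
      rfl
    obtain ⟨p, hp⟩ := ih _ _ hcard
    exact ⟨.cons hadj p, by simp [hp]⟩

/-- The graph distance in a product of complete graphs is the Hamming distance. -/
theorem completeProduct_dist {d : ℕ} {r : Fin d → ℕ} (u v : ∀ i, Fin (r i)) :
    (completeProduct r).dist u v = hammingDist u v := by
  obtain ⟨p, hp⟩ := exists_walk_length_eq_hammingDist _ u v rfl
  refine le_antisymm (hp ▸ SimpleGraph.dist_le p) ?_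
  obtain ⟨q, hq⟩ := (SimpleGraph.Walk.reachable p).exists_walk_length_eq_dist
  exact hq ▸ hammingDist_le_length q

/-! ### Between sets, slices and the swap injection -/

theorem hammingDist_cons {d : ℕ} {r : Fin (d + 1) → ℕ} (x y : Fin (r 0))
    (u v : ∀ i : Fin d, Fin (r i.succ)) :
    hammingDist (Fin.cons x u : ∀ i, Fin (r i)) (Fin.cons y v : ∀ i, Fin (r i)) =
      (if x = y then 0 else 1) + hammingDist u v := by
  unfold hammingDist
  rw [Finset.card_filter, Fin.sum_univ_succ, Finset.card_filter]
  simp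

open Classical in
/-- The vertices `u` lying between some `a ∈ S` and `b ∈ T` for which `j + dist a u` is the value
prescribed by `k` at `j + l + dist a b`. -/
noncomputable def betweenSet {d : ℕ} {r : Fin d → ℕ} (k : ℕ → ℕ) (j l : ℕ)
    (S T : Finset (∀ i, Fin (r i))) : Finset (∀ i, Fin (r i)) :=
  Finset.univ.filter fun u => ∃ a ∈ S, ∃ b ∈ T,
    hammingDist a u + hammingDist u b = hammingDist a b ∧
      j + hammingDist a u = k (j + l + hammingDist a b)

theorem mem_betweenSet {d : ℕ} {r : Fin d → ℕ} {k : ℕ → ℕ} {j l : ℕ}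
    {S T : Finset (∀ i, Fin (r i))} {u : ∀ i, Fin (r i)} :
    u ∈ betweenSet k j l S T ↔ ∃ a ∈ S, ∃ b ∈ T,
      hammingDist a u + hammingDist u b = hammingDist a b ∧
        j + hammingDist a u = k (j + l + hammingDist a b) := by
  simp [betweenSet]

/-- The slice of a set of vertices over a value of the first coordinate. -/
def firstSlice {d : ℕ} {r : Fin (d + 1) → ℕ} (S : Finset (∀ i, Fin (r i))) (x : Fin (r 0)) :
    Finset (∀ i : Fin d, Fin (r i.succ)) :=
  Finset.univ.filter fun v => (Fin.cons x v : ∀ i, Fin (r i)) ∈ S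

theorem mem_firstSlice {d : ℕ} {r : Fin (d + 1) → ℕ} {S : Finset (∀ i, Fin (r i))}
    {x : Fin (r 0)} {v : ∀ i : Fin d, Fin (r i.succ)} :
    v ∈ firstSlice S x ↔ (Fin.cons x v : ∀ i, Fin (r i)) ∈ S := by
  simp [firstSlice]

theorem card_eq_sum_firstSlice {d : ℕ} {r : Fin (d + 1) → ℕ} (S : Finset (∀ i, Fin (r i))) :
    S.card = ∑ x, (firstSlice S x).card := by
  rw [Finset.card_eq_sum_card_fiberwise (f := fun u => u 0) (t := Finset.univ)
    (fun _ _ => Finset.mem_coe.2 (Finset.mem_univ _))]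
  refine Finset.sum_congr rfl fun x _ => ?_
  symm
  refine Finset.card_bij (fun v _ => (Fin.cons x v : ∀ i, Fin (r i))) ?_ ?_ ?_
  · intro v hv
    simpa [mem_firstSlice] using hv
  · intro v _ w _ h
    exact (Fin.cons_injective2 h).2
  · intro u hu
    obtain ⟨hu, rfl⟩ := Finset.mem_filter.1 hu
    exact ⟨Fin.tail u, by simpa [mem_firstSlice] using hu, Fin.cons_self_tail u⟩

section slices

variable {d : ℕ} {r : Fin (d + 1) → ℕ} {k : ℕ → ℕ} {j l : ℕ} {S T : Finset (∀ i, Fin (r i))}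

theorem betweenSet_slice_same (x : Fin (r 0)) :
    betweenSet k j l (firstSlice S x) (firstSlice T x) ⊆ firstSlice (betweenSet k j l S T) x := by
  intro u hu
  obtain ⟨a, ha, b, hb, h1, h2⟩ := mem_betweenSet.1 hu
  refine mem_firstSlice.2 (mem_betweenSet.2
    ⟨_, mem_firstSlice.1 ha, _, mem_firstSlice.1 hb, ?_, ?_⟩)
  · simpa [hammingDist_cons] using h1
  · simpa [hammingDist_cons] using h2

theorem betweenSet_slice_left {x y : Fin (r 0)} (hxy : x ≠ y) :
    betweenSet k j (l + 1) (firstSlice S x) (firstSlice T y) ⊆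
      firstSlice (betweenSet k j l S T) x := by
  intro u hu
  obtain ⟨a, ha, b, hb, h1, h2⟩ := mem_betweenSet.1 hu
  refine mem_firstSlice.2 (mem_betweenSet.2
    ⟨_, mem_firstSlice.1 ha, _, mem_firstSlice.1 hb, ?_, ?_⟩)
  · simp only [hammingDist_cons, if_neg hxy, if_true]
    omega
  · simp only [hammingDist_cons, if_neg hxy, if_true]
    rw [zero_add, h2]
    congr 1
    omega

theorem betweenSet_slice_right {x y : Fin (r 0)} (hxy : x ≠ y) :
    betweenSet k (j + 1) l (firstSlice S x) (firstSlice T y) ⊆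
      firstSlice (betweenSet k j l S T) y := by
  intro u hu
  obtain ⟨a, ha, b, hb, h1, h2⟩ := mem_betweenSet.1 hu
  refine mem_firstSlice.2 (mem_betweenSet.2
    ⟨_, mem_firstSlice.1 ha, _, mem_firstSlice.1 hb, ?_, ?_⟩)
  · simp only [hammingDist_cons, if_neg hxy, if_true]
    omega
  · simp only [hammingDist_cons, if_neg hxy]
    rw [← add_assoc, h2]
    congr 1
    omega

end slices

/-- Swapping each pair `(a, b)` on a subset of prescribed size of the coordinates in which they
differ is injective. -/
theorem card_mul_card_le_betweenSet {d : ℕ} {r : Fin d → ℕ} {k : ℕ → ℕ} {j l : ℕ}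
    {S T : Finset (∀ i, Fin (r i))}
    (h : ∀ a ∈ S, ∀ b ∈ T, j ≤ k (j + l + hammingDist a b) ∧
      k (j + l + hammingDist a b) ≤ j + hammingDist a b) :
    S.card * T.card ≤ (betweenSet k j l S T).card * (betweenSet k j l T S).card := by
  classical
  have hsub : ∀ (D : Finset (Fin d)) (n : ℕ), ∃ B ⊆ D, n ≤ D.card → B.card = n := by
    intro D n
    by_cases hn : n ≤ D.card
    · obtain ⟨B, hB, hc⟩ := Finset.exists_subset_card_eq hn
      exact ⟨B, hB, fun _ => hc⟩
    · exact ⟨∅, by simp, fun h => absurd h hn⟩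
  choose sub hsub hcard using hsub
  let D : (∀ i, Fin (r i)) × (∀ i, Fin (r i)) → Finset (Fin d) :=
    fun p => Finset.univ.filter fun i => p.1 i ≠ p.2 i
  have hD : ∀ p, hammingDist p.1 p.2 = (D p).card := fun p => rfl
  -- The swapped set depends only on the set of differing coordinates, which swapping preserves.
  -- Hence it can be recovered from the image, and swapping again inverts the map.
  let B : Finset (Fin d) → Finset (Fin d) := fun D => sub D (k (j + l + D.card) - j)
  let sw : Finset (Fin d) → (∀ i, Fin (r i)) × (∀ i, Fin (r i)) →
      (∀ i, Fin (r i)) × (∀ i, Fin (r i)) :=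
    fun B p => (fun i => if i ∈ B then p.2 i else p.1 i, fun i => if i ∈ B then p.1 i else p.2 i)
  have hswsw : ∀ B p, sw B (sw B p) = p := by
    intro B p
    ext i <;> by_cases hi : i ∈ B <;> simp [sw, hi]
  have hDsw : ∀ B p, D (sw B p) = D p := by
    intro B p
    ext i
    by_cases hi : i ∈ B <;> simp [sw, D, hi, eq_comm]
  have hin : ∀ p ∈ S ×ˢ T, sw (B (D p)) p ∈ betweenSet k j l S T ×ˢ betweenSet k j l T S := by
    rintro ⟨a, b⟩ hp
    obtain ⟨ha, hb⟩ := Finset.mem_product.1 hp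
    obtain ⟨h1, h2⟩ := h a ha b hb
    have hab := hD (a, b)
    simp only at ha hb hab
    have hBc : (B (D (a, b))).card = k (j + l + hammingDist a b) - j := by
      rw [hab]
      exact hcard _ _ (by rw [← hab]; omega)
    have hBs : B (D (a, b)) ⊆ D (a, b) := hsub _ _
    generalize B (D (a, b)) = C at hBc hBs
    have hne : ∀ i ∈ C, a i ≠ b i := fun i hi => (Finset.mem_filter.1 (hBs hi)).2
    have e1 : ∀ a' b' : (∀ i, Fin (r i)), (∀ i ∈ C, a' i ≠ b' i) →
        hammingDist a' (fun i => if i ∈ C then b' i else a' i) = C.card := by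
      intro a' b' hne
      unfold hammingDist
      congr 1
      ext i
      by_cases hi : i ∈ C <;> simp [hi, hne]
    have e2 : ∀ a' b' : (∀ i, Fin (r i)), D (a', b') = D (a, b) →
        hammingDist (fun i => if i ∈ C then b' i else a' i) b' = (D (a, b)).card - C.card := by
      intro a' b' hd
      rw [← Finset.card_sdiff_of_subset hBs, ← hd]
      unfold hammingDist
      congr 1
      ext i
      by_cases hi : i ∈ C <;> simp [hi, D]
    have hle := Finset.card_le_card hBs
    have hDba : D (b, a) = D (a, b) := by
      ext i; simp [D, eq_comm]
    refine Finset.mem_product.2 ⟨mem_betweenSet.2 ⟨a, ha, b, hb, ?_, ?_⟩,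
      mem_betweenSet.2 ⟨b, hb, a, ha, ?_, ?_⟩⟩
    · simp only [sw]
      rw [e1 a b hne, e2 a b rfl, hab]
      omega
    · simp only [sw]
      rw [e1 a b hne]
      omega
    · simp only [sw]
      rw [e1 b a (fun i hi => (hne i hi).symm), e2 b a hDba, hammingDist_comm b a, hab]
      omega
    · simp only [sw]
      rw [e1 b a (fun i hi => (hne i hi).symm), hammingDist_comm b a]
      omega
  rw [← Finset.card_product, ← Finset.card_product]
  refine Finset.card_le_card_of_injOn (fun p => sw (B (D p)) p) hin ?_
  intro p _ q _ hpq
  simp only at hpq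
  have hDD : D p = D q := by
    have := congrArg D hpq
    rwa [hDsw, hDsw] at this
  rw [← hswsw (B (D p)) p, hpq, hDD, hswsw]

/-- The logarithmic gain available from the state `(j, l)`. -/
noncomputable def gain (c β M : ℝ) (j l : ℕ) : ℝ :=
  c * (M - (j + l)) - β * (((j : ℝ) - l) ^ 2 - (j + l) + M)

/-- In `gain`, the term `(j - l)² - (j + l)` is unchanged on average under the steps `(j + 1, l)`
and `(j, l + 1)`, so it penalises imbalance at no cost in the recursion. By `hH` it makes the gain
nonpositive when `|j - l| = H`. -/
theorem card_mul_card_exp_le_betweenSet {k : ℕ → ℕ} {N M H d₀ : ℕ} {c β : ℝ} (hc : 0 ≤ c)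
    (hβ : 0 ≤ β) (hH : c * M ≤ β * (H : ℝ) ^ 2) (hMN : M ≤ N)
    (hk : ∀ n j l : ℕ, N ≤ n → n ≤ d₀ → j + l ≤ M → j ≤ l + H → l ≤ j + H →
      j ≤ k n ∧ k n + l ≤ n) (d : ℕ) :
    ∀ (r : Fin d → ℕ) (S T : Finset (∀ i, Fin (r i))) (j l : ℕ), j + l + d ≤ d₀ → j + l ≤ M →
      j ≤ l + H → l ≤ j + H → (∀ a ∈ S, ∀ b ∈ T, N ≤ j + l + hammingDist a b) →
      (S.card : ℝ) * T.card * Real.exp (2 * gain c β M j l - c ^ 2 * d) ≤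
        (betweenSet k j l S T).card * (betweenSet k j l T S).card := by
  have boundary : ∀ (d : ℕ) (r : Fin d → ℕ) (S T : Finset (∀ i, Fin (r i))) (j l : ℕ),
      j + l + d ≤ d₀ → j + l ≤ M → j ≤ l + H → l ≤ j + H →
      (∀ a ∈ S, ∀ b ∈ T, N ≤ j + l + hammingDist a b) →
      (j + l = M ∨ j = l + H ∨ l = j + H) →
      (S.card : ℝ) * T.card * Real.exp (2 * gain c β M j l - c ^ 2 * d) ≤
        (betweenSet k j l S T).card * (betweenSet k j l T S).card := by
    intro d r S T j l hd hM h1 h2 hST hbd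
    have hcard : S.card * T.card ≤ (betweenSet k j l S T).card * (betweenSet k j l T S).card := by
      refine card_mul_card_le_betweenSet fun a ha b hb => ?_
      have hle : hammingDist a b ≤ d := by simpa using hammingDist_le_card_fintype (x := a) (y := b)
      have := hk (j + l + hammingDist a b) j l (hST a ha b hb) (by omega) hM h1 h2
      omega
    have hgain : gain c β M j l ≤ 0 := by
      unfold gain
      have hMr : (j : ℝ) + l ≤ M := by exact_mod_cast hM
      have hjl : (0 : ℝ) ≤ j + l := by positivity
      rcases hbd with h | h
      · have : (j : ℝ) + l = M := by exact_mod_cast h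
        rw [← this]
        have : 0 ≤ β * ((j : ℝ) - l) ^ 2 := by positivity
        linarith
      · have hsq : ((j : ℝ) - l) ^ 2 = (H : ℝ) ^ 2 := by
          rcases h with h | h <;> (rw [h]; push_cast; ring)
        rw [hsq]
        nlinarith [mul_nonneg hβ (sub_nonneg.2 hMr), mul_nonneg hc hjl]
    have hexp : Real.exp (2 * gain c β M j l - c ^ 2 * d) ≤ 1 := by
      rw [Real.exp_le_one_iff]
      have : 0 ≤ c ^ 2 * d := by positivity
      linarith
    calc (S.card : ℝ) * T.card * Real.exp (2 * gain c β M j l - c ^ 2 * d)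
        ≤ (S.card : ℝ) * T.card * 1 := by gcongr
      _ ≤ _ := by rw [mul_one]; exact_mod_cast hcard
  induction d with
  | zero =>
    intro r S T j l hd hM h1 h2 hST
    by_cases hs : j + l = M
    · exact boundary 0 r S T j l hd hM h1 h2 hST (Or.inl hs)
    -- In dimension zero, `j + l < M ≤ N` contradicts the distance hypothesis unless `S` or `T` is
    -- empty.
    · have : S.card * T.card = 0 := by
        by_contra hne
        obtain ⟨a, ha⟩ := Finset.card_pos.1 (Nat.pos_of_ne_zero (left_ne_zero_of_mul hne))
        obtain ⟨b, hb⟩ := Finset.card_pos.1 (Nat.pos_of_ne_zero (right_ne_zero_of_mul hne))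
        have := hST a ha b hb
        have hle : hammingDist a b ≤ 0 := by
          simpa using hammingDist_le_card_fintype (x := a) (y := b)
        omega
      rw [← Nat.cast_mul, this]
      simp only [Nat.cast_zero, zero_mul]
      positivity
  | succ d ih =>
    intro r S T j l hd hM h1 h2 hST
    by_cases hs : j + l = M ∨ j = l + H ∨ l = j + H
    · exact boundary (d + 1) r S T j l hd hM h1 h2 hST hs
    push Not at hs
    obtain ⟨hs1, hs2, hs3⟩ := hs
    have hdist : ∀ x y, ∀ a ∈ firstSlice S x, ∀ b ∈ firstSlice T y,
        N ≤ j + l + ((if x = y then 0 else 1) + hammingDist a b) := by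
      intro x y a ha b hb
      rw [← hammingDist_cons]
      exact hST _ (mem_firstSlice.1 ha) _ (mem_firstSlice.1 hb)
    have card_le : ∀ {A A' B B' : Finset (∀ i : Fin d, Fin (r i.succ))}, A ⊆ A' → B ⊆ B' →
        (A.card : ℝ) * B.card ≤ A'.card * B'.card := fun h h' => by
      have := Finset.card_le_card h
      have := Finset.card_le_card h'
      gcongr
    have key := sum_mul_sum_exp_le (c := c)
      (s := fun x => ((firstSlice S x).card : ℝ)) (t := fun x => ((firstSlice T x).card : ℝ))
      (α := fun x => ((firstSlice (betweenSet k j l S T) x).card : ℝ))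
      (β := fun x => ((firstSlice (betweenSet k j l T S) x).card : ℝ))
      (E := 2 * gain c β M j l - c ^ 2 * d) (E₁ := 2 * gain c β M j (l + 1) - c ^ 2 * d)
      (E₂ := 2 * gain c β M (j + 1) l - c ^ 2 * d) hc (fun x => by positivity)
      (fun x => by positivity) (fun x => by positivity) (fun x => by positivity)
      (by unfold gain; push_cast; ring)
      (fun x => (ih _ _ _ j l (by omega) hM h1 h2
        (fun a ha b hb => by simpa using hdist x x a ha b hb)).trans
          (card_le (betweenSet_slice_same x) (betweenSet_slice_same x)))
      (fun x y hxy => (ih _ _ _ j (l + 1) (by omega) (by omega) (by omega) (by omega)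
        (fun a ha b hb => by
          have := hdist x y a ha b hb
          rw [if_neg hxy] at this; omega)).trans
          (card_le (betweenSet_slice_left hxy) (betweenSet_slice_left hxy.symm)))
      (fun x y hxy => (ih _ _ _ (j + 1) l (by omega) (by omega) (by omega) (by omega)
        (fun a ha b hb => by
          have := hdist x y a ha b hb
          rw [if_neg hxy] at this; omega)).trans
          (card_le (betweenSet_slice_right hxy) (betweenSet_slice_right hxy.symm)))
    rw [card_eq_sum_firstSlice S, card_eq_sum_firstSlice T,
      card_eq_sum_firstSlice (betweenSet k j l S T), card_eq_sum_firstSlice (betweenSet k j l T S)]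
    push_cast
    refine le_trans (le_of_eq ?_) key
    congr 2
    ring

/-! ### Midpoints and choice of parameters -/

theorem setDist_le_dist {V : Type*} {G : SimpleGraph V} {S T : Set V} {a b : V} (ha : a ∈ S)
    (hb : b ∈ T) : setDist G S T ≤ G.dist a b :=
  Nat.sInf_le ⟨a, ha, b, hb, rfl⟩

theorem betweenSet_subset_symMidpointSet {d : ℕ} {r : Fin d → ℕ} {ρ : ℝ} (hρ : 0 ≤ ρ)
    {S T : Finset (∀ i, Fin (r i))} :
    (betweenSet (fun n : ℕ => ⌊ρ * n⌋₊) 0 0 S T : Set (∀ i, Fin (r i))) ⊆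
      symMidpointSet (completeProduct r) ρ S T := by
  intro u hu
  obtain ⟨a, ha, b, hb, h1, h2⟩ := mem_betweenSet.1 (Finset.mem_coe.1 hu)
  simp only [zero_add] at h2
  refine Set.mem_biUnion ha (Set.mem_biUnion hb (Or.inl ?_))
  simp only [Set.mem_ofPred_eq, completeProduct_dist]
  exact ⟨by rw [h2, Int.natCast_floor_eq_floor (by positivity)], h1⟩

/-- Distance `⌊ρn⌋` from `b` is distance `n - ⌊ρn⌋ = ⌈(1 - ρ)n⌉` from `a`, which is the second
alternative in `symMidpoints`. -/
theorem betweenSet_swap_subset_symMidpointSet {d : ℕ} {r : Fin d → ℕ} {ρ : ℝ} (hρ : 0 ≤ ρ)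
    {S T : Finset (∀ i, Fin (r i))} :
    (betweenSet (fun n : ℕ => ⌊ρ * n⌋₊) 0 0 T S : Set (∀ i, Fin (r i))) ⊆
      symMidpointSet (completeProduct r) ρ S T := by
  intro u hu
  obtain ⟨b, hb, a, ha, h1, h2⟩ := mem_betweenSet.1 (Finset.mem_coe.1 hu)
  simp only [zero_add] at h2
  rw [hammingDist_comm b u, hammingDist_comm u a, hammingDist_comm b a] at h1
  rw [hammingDist_comm b u, hammingDist_comm b a] at h2
  refine Set.mem_biUnion ha (Set.mem_biUnion hb (Or.inr ?_))
  simp only [Set.mem_ofPred_eq, completeProduct_dist]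
  refine ⟨?_, by omega⟩
  have h3 : (hammingDist u b : ℤ) = ⌊ρ * (hammingDist a b : ℝ)⌋ := by
    rw [h2, Int.natCast_floor_eq_floor (by positivity)]
  have h4 : (1 - ρ) * (hammingDist a b : ℝ) =
      -(ρ * (hammingDist a b : ℝ)) + (hammingDist a b : ℕ) := by ring
  rw [h4, Int.ceil_add_natCast, Int.ceil_neg, ← h3]
  omega

theorem mul_le_sq_ncard_symMidpointSet {d : ℕ} {r : Fin d → ℕ} {ρ : ℝ} (hρ : 0 ≤ ρ)
    (S T : Finset (∀ i, Fin (r i))) :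
    ((betweenSet (fun n : ℕ => ⌊ρ * n⌋₊) 0 0 S T).card : ℝ) *
        (betweenSet (fun n : ℕ => ⌊ρ * n⌋₊) 0 0 T S).card ≤
      ((symMidpointSet (completeProduct r) ρ (S : Set _) T).ncard : ℝ) ^ 2 := by
  have h1 := Set.ncard_le_ncard (betweenSet_subset_symMidpointSet hρ (S := S) (T := T))
    (Set.toFinite _)
  have h2 := Set.ncard_le_ncard (betweenSet_swap_subset_symMidpointSet hρ (S := S) (T := T))
    (Set.toFinite _)
  rw [Set.ncard_coe_finset] at h1 h2
  rw [sq]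
  gcongr

/-- Both `j` and `l` are at most `(M + H) / 2`, about `(δ - 3ε)d / 2`, while `ρn` and `(1 - ρ)n` are
at least `(1/2 - ε)n`, hence at least `(δ/2 - ε)d`. The remaining margin absorbs the rounding. -/
theorem le_floor_and_floor_add_le {δ ε ρ : ℝ} {d M H n j l : ℕ} (hρ0 : 0 ≤ ρ)
    (hρ : |1 / 2 - ρ| < ε) (hd : 3 ≤ ε * d) (hM : (M : ℝ) ≤ (δ - 4 * ε) * d)
    (hH : (H : ℝ) ≤ ε * d + 1) (hn : δ * d ≤ n) (hnd : n ≤ d) (hjl : j + l ≤ M)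
    (h1 : j ≤ l + H) (h2 : l ≤ j + H) : j ≤ ⌊ρ * n⌋₊ ∧ ⌊ρ * n⌋₊ + l ≤ n := by
  have hε : 0 < ε := (abs_nonneg _).trans_lt hρ
  obtain ⟨ha, hb⟩ := abs_lt.1 hρ
  have hnd' : (n : ℝ) ≤ d := by exact_mod_cast hnd
  have hn0 : (0 : ℝ) ≤ n := by positivity
  have hjl' : (j : ℝ) + l ≤ M := by exact_mod_cast hjl
  have h1' : (j : ℝ) ≤ l + H := by exact_mod_cast h1
  have h2' : (l : ℝ) ≤ j + H := by exact_mod_cast h2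
  have e1 : ε * n ≤ ε * d := by gcongr
  have e2 : (1 / 2 - ρ) * n ≤ ε * n := by gcongr
  have e3 : (ρ - 1 / 2) * n ≤ ε * n := by gcongr; linarith
  constructor
  · rw [Nat.le_floor_iff (by positivity)]
    linarith
  · have := Nat.floor_le (show 0 ≤ ρ * n by positivity)
    have h : (⌊ρ * n⌋₊ : ℝ) + l ≤ n := by linarith
    exact_mod_cast h

/-- Since `δ ≤ 1`, `(δ - 4ε)² ≥ δ² - 8ε`, whereas `16 log 2 > 11`. The spare `3εd` pays for the
rounding of `M` (at most `2`) and the imbalance penalty (at most `2 / ε²`). -/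
theorem exponent_lt {δ ε : ℝ} (hε : 0 < ε) (hδ : δ ≤ 1) (h4 : 0 ≤ δ - 4 * ε) {d M H : ℕ}
    (hd : 2 + 2 / ε ^ 2 < 3 * ε * d) (hd0 : 0 < d) (hM : (M : ℝ) ≤ (δ - 4 * ε) * d)
    (hM' : (δ - 4 * ε) * d - 1 ≤ M) (hH : ε * d ≤ H) :
    (δ ^ 2 - 16 * Real.log 2 * ε) * d <
      2 * gain ((M : ℝ) / d) ((M : ℝ) / d * M / (H : ℝ) ^ 2) M 0 0 - ((M : ℝ) / d) ^ 2 * d := by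
  have hd' : (0 : ℝ) < d := by exact_mod_cast hd0
  have hH0 : (0 : ℝ) < H := lt_of_lt_of_le (by positivity) hH
  have hgain : 2 * gain ((M : ℝ) / d) ((M : ℝ) / d * M / (H : ℝ) ^ 2) M 0 0 - ((M : ℝ) / d) ^ 2 * d
      = (M : ℝ) ^ 2 / d - 2 * ((M : ℝ) ^ 3 / (d * (H : ℝ) ^ 2)) := by
    unfold gain
    push_cast
    field_simp
    ring
  rw [hgain]
  have hMd : (M : ℝ) ≤ d := by nlinarith
  have h1 : (M : ℝ) ^ 3 / (d * (H : ℝ) ^ 2) ≤ 1 / ε ^ 2 := by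
    rw [div_le_div_iff₀ (by positivity) (by positivity)]
    calc (M : ℝ) ^ 3 * ε ^ 2 ≤ (d : ℝ) ^ 3 * ε ^ 2 := by gcongr
      _ = d * (ε * d) ^ 2 := by ring
      _ ≤ 1 * (d * (H : ℝ) ^ 2) := by rw [one_mul]; gcongr
  have h2 : (δ - 4 * ε) ^ 2 * d - 2 ≤ (M : ℝ) ^ 2 / d := by
    rw [le_div_iff₀ hd']
    set x := (δ - 4 * ε) * d with hx
    have hxd : x ≤ d := by nlinarith
    have hx0 : 0 ≤ x := by positivity
    have : ((δ - 4 * ε) ^ 2 * d - 2) * d = x ^ 2 - 2 * d := by rw [hx]; ring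
    rw [this]
    nlinarith [sq_nonneg ((M : ℝ) - x), mul_nonneg hx0 (by linarith : 0 ≤ (M : ℝ) - (x - 1))]
  have hlog := Real.log_two_gt_d9
  have h3 : δ * (ε * d) ≤ 1 * (ε * d) := by gcongr
  have h5 : 0 ≤ ε ^ 2 * d := by positivity
  have h6 : 0.6931471803 * (ε * d) ≤ Real.log 2 * (ε * d) := by gcongr
  have h7 : 2 / ε ^ 2 = 2 * (1 / ε ^ 2) := by ring
  have h8 : 0 < ε * d := by positivity
  nlinarith

theorem mainTheorem9 (δ ε : ℝ) (hδ : 0 < δ) (hC : 0 < δ ^ 2 - 16 * Real.log 2 * ε) :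
    ∃ o : ℕ → ℝ, Tendsto o atTop (𝓝 0) ∧
      ∀ᶠ d : ℕ in atTop, ∀ ρ : ℝ, |1 / 2 - ρ| < ε →
        ∀ (r : Fin d → ℕ) (S T : Set (∀ i, Fin (r i))), S.Nonempty → T.Nonempty →
          δ * (d : ℝ) ≤ (setDist (completeProduct r) S T : ℝ) →
          Real.sqrt ((S.ncard : ℝ) * (T.ncard : ℝ)) *
              Real.exp ((δ ^ 2 - 16 * Real.log 2 * ε) * (d : ℝ) * (1 / 2 + o d)) <
            ((symMidpointSet (completeProduct r) ρ S T).ncard : ℝ) := by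
  refine ⟨fun _ => 0, tendsto_const_nhds, ?_⟩
  rcases le_or_gt ε 0 with hε | hε
  · exact Eventually.of_forall fun d ρ hρ => absurd hρ (not_lt.2 (hε.trans (abs_nonneg _)))
  have hlarge : ∀ᶠ d : ℕ in atTop, (3 + 2 / ε ^ 2) / ε ≤ (d : ℝ) :=
    tendsto_natCast_atTop_atTop.eventually_ge_atTop _
  filter_upwards [hlarge, eventually_gt_atTop 0] with d hd hd0 ρ hρ r S T hS hT hST
  classical
  rw [div_le_iff₀ hε] at hd
  have hd' : (0 : ℝ) < d := by exact_mod_cast hd0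
  have hε2 : 0 < 2 / ε ^ 2 := by positivity
  obtain ⟨S, rfl⟩ := S.toFinite.exists_finset_coe
  obtain ⟨T, rfl⟩ := T.toFinite.exists_finset_coe
  have hdist : ∀ a ∈ S, ∀ b ∈ T, δ * d ≤ hammingDist a b := by
    intro a ha b hb
    refine hST.trans ?_
    rw [← completeProduct_dist]
    exact_mod_cast setDist_le_dist (G := completeProduct r) (S := (S : Set _)) (T := (T : Set _))
      (Finset.mem_coe.2 ha) (Finset.mem_coe.2 hb)
  have hδ1 : δ ≤ 1 := by
    obtain ⟨a, ha⟩ := hS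
    obtain ⟨b, hb⟩ := hT
    have h1 := hdist a ha b hb
    have h2 : hammingDist a b ≤ d := by simpa using hammingDist_le_card_fintype (x := a) (y := b)
    have h3 : (hammingDist a b : ℝ) ≤ d := by exact_mod_cast h2
    nlinarith
  have hlog := Real.log_two_gt_d9
  have hεδ : 11 * ε < δ ^ 2 := by nlinarith
  have hδδ : δ ^ 2 ≤ δ := by nlinarith
  have hρ0 : 0 ≤ ρ := by
    have := (abs_lt.1 hρ).2
    linarith
  set M := ⌊(δ - 4 * ε) * d⌋₊ with hMdef
  set H := ⌈ε * d⌉₊ with hHdef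
  have h4 : 0 ≤ δ - 4 * ε := by linarith
  have hM : (M : ℝ) ≤ (δ - 4 * ε) * d := Nat.floor_le (by positivity)
  have hM' : (δ - 4 * ε) * d - 1 ≤ M := (Nat.sub_one_lt_floor _).le
  have hH : ε * d ≤ H := Nat.le_ceil _
  have hH' : (H : ℝ) ≤ ε * d + 1 := (Nat.ceil_lt_add_one (by positivity)).le
  have hH0 : (0 : ℝ) < H := lt_of_lt_of_le (by positivity) hH
  have hMN : M ≤ ⌈δ * d⌉₊ := by
    have h1 := Nat.le_ceil (δ * d)
    have h2 : (M : ℝ) ≤ ⌈δ * d⌉₊ := by nlinarith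
    exact_mod_cast h2
  -- The choice `c = M / d` maximises `2cM - c²d`, and `β` is taken to make `hH` an equality.
  have key := card_mul_card_exp_le_betweenSet (k := fun n : ℕ => ⌊ρ * n⌋₊) (N := ⌈δ * d⌉₊)
    (M := M) (H := H) (d₀ := d) (c := (M : ℝ) / d) (β := (M : ℝ) / d * M / (H : ℝ) ^ 2)
    (by positivity) (by positivity) (le_of_eq (by field_simp)) hMN
    (fun n j l hn hnd hjl h1 h2 => le_floor_and_floor_add_le hρ0 hρ (by linarith) hM hH'
      (Nat.ceil_le.1 hn) hnd hjl h1 h2) d r S T 0 0 (by omega) (by omega) (by omega) (by omega)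
    (fun a ha b hb => by
      rw [Nat.ceil_le]
      simpa using hdist a ha b hb)
  have hexp := exponent_lt (H := H) hε hδ1 h4 (by nlinarith) hd0 hM hM' hH
  have hSpos : (0 : ℝ) < S.card := by exact_mod_cast Finset.card_pos.2 (by simpa using hS)
  have hTpos : (0 : ℝ) < T.card := by exact_mod_cast Finset.card_pos.2 (by simpa using hT)
  rw [Set.ncard_coe_finset, Set.ncard_coe_finset]
  refine lt_of_pow_lt_pow_left₀ 2 (by positivity) ?_
  refine lt_of_lt_of_le ?_ (key.trans (mul_le_sq_ncard_symMidpointSet hρ0 S T))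
  rw [mul_pow, Real.sq_sqrt (by positivity), ← Real.exp_nat_mul]
  refine mul_lt_mul_of_pos_left ?_ (by positivity)
  rw [Real.exp_lt_exp]
  refine lt_of_eq_of_lt ?_ hexp
  push_cast
  ring
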